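/- Let $\mathcal H$ be a real separable Hilbert space with norm $\|\cdot\|$ and let $(\mathcal P_t)_{t\ge 0}$ be a Markov semigroup on $\mathcal H$, that is, a family of Borel probability transition kernels with $\mathcal P_0(u,\cdot)=\delta_u$ and $\mathcal P_{s+t}(u,A)=\int_{\mathcal H}\mathcal P_s(v,A)\,\mathcal P_t(u,dv)$; it acts on bounded measurable functions by $\mathcal P_t\phi(u)=\int_{\mathcal H}\phi(v)\,\mathcal P_t(u,dv)$. Suppose that there exist a non-decreasing sequence $(t_n)$ of positive times, a sequence $(\delta_n)$ of positive numbers converging to $0$ and a non-decreasing function $C:\mathbb R_+\to\mathbb R$ such that, for every Fréchet differentiable $\phi:\mathcal H\to\mathbb R$ for which $\|\phi\|_\infty=\sup_u|\phi(u)|$ and $\|\mathrm D\phi\|_\infty=\sup_u\|\mathrm D\phi(u)\|$ are finite, and for all $n$, the function $\mathcal P_{t_n}\phi$ is Fréchet differentiable and $$\|\mathrm D\mathcal P_{t_n}\phi(u)\|\le C(\|u\|)\bigl(\|\phi\|_\infty+\delta_n\|\mathrm D\phi\|_\infty\bigr)\qquad\text{for all }u\in\mathcal H .$$ Suppose furthermore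 that for every $R_0>0$ there exist $R>0$ and $T>0$ such that for every $\varepsilon>0$ there is a point $v\in\mathcal H$ with $\|v\|\le R$ such that $\mathcal P_T(u,B_\varepsilon(v))>0$ for every $u\in\mathcal H$ with $\|u\|\le R_0$, where $B_\varepsilon(v)=\{w:\|w-v\|<\varepsilon\}$. Then there is at most one Borel probability measure $\mu$ on $\mathcal H$ that is invariant for $(\mathcal P_t)$, i.e. satisfies $\int_{\mathcal H}\mathcal P_t(u,\cdot)\,\mu(du)=\mu$ for all $t\ge 0$. -/

import Mathlib

open MeasureTheory ProbabilityTheory Filter Topology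
open scoped NNReal

/-- A Markov semigroup in continuous time on the measurable space `X`: a family of Markov
transition kernels `P t`, `t ≥ 0`, with `P 0 (x, ·) = δ_x` and the Chapman–Kolmogorov equation
`P (s + t) (x, A) = ∫ P s (y, A) P t (x, dy)`. -/
structure IsMarkovSemigroup {X : Type*} [MeasurableSpace X] (P : ℝ≥0 → Kernel X X) : Prop where
  isMarkovKernel : ∀ t, IsMarkovKernel (P t)
  zero : P 0 = Kernel.id
  add : ∀ s t, P (s + t) = P s ∘ₖ P t

/-- The action of a Markov semigroup on functions, `(P_t φ)(u) = ∫ φ(v) P_t(u, dv)`. -/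
noncomputable def semigroupAction {X : Type*} [MeasurableSpace X] (P : ℝ≥0 → Kernel X X)
    (t : ℝ≥0) (φ : X → ℝ) (u : X) : ℝ :=
  ∫ v, φ v ∂(P t u)

/-- The supremum norm `‖f‖_∞ = sup_x ‖f x‖`; it is the true supremum only if `f` is bounded, which
is required separately wherever the norm is used. -/
noncomputable def supNorm {X E : Type*} [Norm E] (f : X → E) : ℝ := ⨆ x, ‖f x‖

/-- `f` has finite supremum norm. -/
def HasFiniteSupNorm {X E : Type*} [Norm E] (f : X → E) : Prop :=
  BddAbove (Set.range fun x => ‖f x‖)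

/-- The gradient estimate
`‖D P_{t_n} φ (u)‖ ≤ C(‖u‖) (‖φ‖_∞ + δ_n ‖D φ‖_∞)` for all `n` and `u`, and all Fréchet
differentiable `φ : H → ℝ` such that `‖φ‖_∞` and `‖D φ‖_∞` are finite. The differentiability of
`P_{t_n} φ` is part of the estimate. -/
def GradientEstimate {H : Type*} [NormedAddCommGroup H] [InnerProductSpace ℝ H]
    [MeasurableSpace H] (P : ℝ≥0 → Kernel H H) (t : ℕ → ℝ≥0) (δ : ℕ → ℝ) (C : ℝ≥0 → ℝ) : Prop :=
  ∀ φ : H → ℝ, Differentiable ℝ φ → HasFiniteSupNorm φ → HasFiniteSupNorm (fderiv ℝ φ) →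
    ∀ n, Differentiable ℝ (semigroupAction P (t n) φ) ∧
      ∀ u, ‖fderiv ℝ (semigroupAction P (t n) φ) u‖ ≤
        C ‖u‖₊ * (supNorm φ + δ n * supNorm (fderiv ℝ φ))

/-- `μ` is invariant for the semigroup: `∫ P_t(u, ·) μ(du) = μ` for every `t ≥ 0`. -/
def IsInvariantFor {X : Type*} [MeasurableSpace X] (P : ℝ≥0 → Kernel X X) (μ : Measure X) : Prop :=
  ∀ t, Kernel.Invariant (P t) μ

/-! Two distinct invariant probability measures yield two mutually singular ones
(`exists_mutuallySingular_of_ne`). By irreducibility both charge a common ball, whose radius can be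
fixed in advance from `C`. The gradient estimate makes `P_{t_n} φ` nearly constant on that ball,
with `n` depending on `φ` but the oscillation bound not
(`GradientEstimate.exists_lipschitz_on_ball`). By invariance `φ` and `P_{t_n} φ` have the same
integrals, so for every test function `φ` with values in `[0, 1]` these differ by at most a fixed
number below one; singularity provides a `φ` exceeding it. -/

namespace ProbabilityTheory.Kernel.Invariant

variable {X : Type*} [MeasurableSpace X] {κ : Kernel X X} {μ ν : Measure X}

/-- `μ - ν` is the least measure whose sum with `ν` dominates `μ`. Its image under `κ` has this
property too, hence dominates it; a Markov kernel preserves mass, so the two agree. -/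
theorem sub [IsMarkovKernel κ] [IsFiniteMeasure μ] [IsFiniteMeasure ν]
    (hμ : κ.Invariant μ) (hν : κ.Invariant ν) : κ.Invariant (μ - ν) := by
  have hle : μ - ν ≤ κ ∘ₘ (μ - ν) := by
    rw [Measure.sub_le_iff_le_add]
    calc μ = κ ∘ₘ μ := hμ.def.symm
      _ ≤ κ ∘ₘ (μ - ν + ν) := by
        refine Measure.le_iff.2 fun s hs => ?_
        rw [Measure.bind_apply hs κ.aemeasurable, Measure.bind_apply hs κ.aemeasurable]
        exact lintegral_mono' (Measure.sub_le_iff_le_add.1 le_rfl) le_rfl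
      _ = κ ∘ₘ (μ - ν) + ν := by rw [Measure.comp_add]; congr 1
  exact (Measure.eq_of_le_of_measure_univ_eq hle (by simp)).symm

theorem smul (c : ENNReal) (hμ : κ.Invariant μ) : κ.Invariant (c • μ) := by
  rw [Invariant, Measure.comp_smul, hμ.def]

theorem integral_integral [IsMarkovKernel κ] (hμ : κ.Invariant μ) {f : X → ℝ}
    (hf : Integrable f μ) : ∫ x, ∫ y, f y ∂κ x ∂μ = ∫ x, f x ∂μ := by
  have hcomp : (κ ∘ₖ Kernel.const Unit μ) () = μ := by
    rw [← Measure.comp_eq_comp_const_apply, hμ.def]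
  have h := Kernel.integral_comp (η := κ) (κ := Kernel.const Unit μ) (a := ()) (f := f)
    (by rwa [hcomp])
  rw [hcomp, Kernel.const_apply] at h
  exact h.symm

theorem measure_pos (hμ : κ.Invariant μ) {A B : Set X}
    (hB : MeasurableSet B) (hA : μ A ≠ 0) (h : ∀ u ∈ A, 0 < κ u B) : 0 < μ B := by
  rw [← hμ.def, Measure.bind_apply hB κ.aemeasurable,
    lintegral_pos_iff_support (κ.measurable_coe hB)]
  exact (pos_iff_ne_zero.2 hA).trans_le (measure_mono fun u hu => (h u hu).ne')

end ProbabilityTheory.Kernel.Invariant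

/-- Two different invariant probability measures give rise to two mutually singular ones. -/
theorem exists_mutuallySingular_of_ne {X : Type*} [MeasurableSpace X] {P : ℝ≥0 → Kernel X X}
    [∀ t, IsMarkovKernel (P t)] {μ ν : Measure X} [IsProbabilityMeasure μ]
    [IsProbabilityMeasure ν] (hμ : IsInvariantFor P μ) (hν : IsInvariantFor P ν) (hne : μ ≠ ν) :
    ∃ μ' ν' : Measure X, IsProbabilityMeasure μ' ∧ IsProbabilityMeasure ν' ∧
      IsInvariantFor P μ' ∧ IsInvariantFor P ν' ∧ μ'.MutuallySingular ν' := by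
  have hμν : μ - ν ≠ 0 := fun h => hne <| Measure.eq_of_le_of_isProbabilityMeasure <| by
    simpa [h] using (Measure.sub_le_iff_le_add (μ := μ) (ν := ν)).1 le_rfl
  -- Equal masses of the two parts allow one normalising constant for both.
  have hmass : (ν - μ) Set.univ = (μ - ν) Set.univ := by
    have h := congrArg (fun σ : SignedMeasure X => σ Set.univ)
      (Measure.sub_toSignedMeasure_eq_toSignedMeasure_sub (μ := μ) (ν := ν))
    simp [measureReal_def] at h
    have h' := sub_eq_zero.1 h.symm
    exact ((ENNReal.toReal_eq_toReal_iff' (measure_ne_top _ _) (measure_ne_top _ _)).1 h').symm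
  have h0 : (μ - ν) Set.univ ≠ 0 := by simpa using hμν
  have : NeZero (μ - ν) := ⟨hμν⟩
  refine ⟨((μ - ν) Set.univ)⁻¹ • (μ - ν), ((μ - ν) Set.univ)⁻¹ • (ν - μ), inferInstance,
    ⟨?_⟩, fun t => ((hμ t).sub (hν t)).smul _, fun t => ((hν t).sub (hμ t)).smul _,
    (Measure.mutually_singular_measure_sub.smul _).symm.smul _ |>.symm⟩
  rw [Measure.smul_apply, hmass, smul_eq_mul, ENNReal.inv_mul_cancel h0 (measure_ne_top _ _)]

/-! ### Smooth separation of singular measures -/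

section Separation

variable {H : Type*} [NormedAddCommGroup H] [InnerProductSpace ℝ H]

/-- A smooth Lipschitz function equal to one near `x` and vanishing far from `x`. -/
theorem exists_differentiable_lipschitz_bump (x : H) {r : ℝ} (hr : 0 < r) :
    ∃ ρ > 0, ∃ b : H → ℝ, Differentiable ℝ b ∧ (∃ K, LipschitzWith K b) ∧ (∀ y, 0 ≤ b y) ∧
      (∀ y ∈ Metric.ball x ρ, b y = 1) ∧ ∀ y, r ≤ dist y x → b y = 0 := by
  set R : ℝ := √(1 + r ^ 2) with hR
  have hR1 : 1 < R := by
    rw [hR, Real.lt_sqrt zero_le_one]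
    nlinarith
  let f : ContDiffBump (1 : ℝ) := ⟨(R - 1) / 2, R - 1, by linarith, by linarith⟩
  obtain ⟨K, hK⟩ := ContDiff.lipschitzWith_of_hasCompactSupport f.hasCompactSupport
    (f.contDiff (n := 1)) one_ne_zero
  -- A smooth substitute for the norm: `q x = 1`, and `q = R` at distance `r` from `x`.
  let q : H → ℝ := fun y => √(1 + ‖y - x‖ ^ 2)
  have hq1 : ∀ y, 1 ≤ q y := fun y => Real.one_le_sqrt.2 (by nlinarith [sq_nonneg ‖y - x‖])
  have hqd : Differentiable ℝ q := by
    refine Differentiable.sqrt ?_ fun y => by positivity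
    exact (differentiable_const _).add ((differentiable_id.sub_const x).norm_sq ℝ)
  have hql : LipschitzWith 1 q := by
    refine LipschitzWith.of_le_add fun y z => ?_
    have h := norm_sub_norm_le (y - x) (z - x)
    rw [sub_sub_sub_cancel_right, ← dist_eq_norm y z] at h
    have hz : ‖z - x‖ ≤ q z := Real.le_sqrt_of_sq_le (by linarith)
    have hq2 : q z ^ 2 = 1 + ‖z - x‖ ^ 2 := Real.sq_sqrt (by positivity)
    have hd : 0 ≤ dist y z := dist_nonneg
    refine Real.sqrt_le_iff.2 ⟨by linarith [hq1 z], ?_⟩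
    have hy : ‖y - x‖ ^ 2 ≤ (‖z - x‖ + dist y z) ^ 2 :=
      pow_le_pow_left₀ (norm_nonneg _) (by linarith) 2
    nlinarith [mul_le_mul_of_nonneg_right hz hd]
  refine ⟨(R - 1) / 2, by linarith, fun y => f (q y), ?_, ⟨K * 1, hK.comp hql⟩,
    fun y => f.nonneg, fun y hy => ?_, fun y hy => ?_⟩
  · exact ((f.contDiff (n := 1)).differentiable one_ne_zero).comp hqd
  · apply f.one_of_mem_closedBall
    have h1 := hql.dist_le_mul y x
    have h2 : q x = 1 := by simp [q]
    rw [h2, NNReal.coe_one, one_mul] at h1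
    exact h1.trans (Metric.mem_ball.1 hy).le
  · apply f.zero_of_le_dist
    have h1 : R ≤ q y := Real.sqrt_le_sqrt (by rw [← dist_eq_norm]; gcongr)
    rw [Real.dist_eq, abs_of_nonneg (by linarith)]
    change R - 1 ≤ q y - 1
    linarith

/-- A compact set and a disjoint closed set are separated by a differentiable Lipschitz function. -/
theorem exists_differentiable_lipschitz_separating {K L : Set H} (hK : IsCompact K)
    (hL : IsClosed L) (hKL : Disjoint K L) :
    ∃ φ : H → ℝ, Differentiable ℝ φ ∧ (∃ C, LipschitzWith C φ) ∧ (∀ y, 0 ≤ φ y) ∧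
      (∀ y, φ y ≤ 1) ∧ (∀ y ∈ K, φ y = 1) ∧ ∀ y ∈ L, φ y = 0 := by
  have hpt : ∀ x ∈ K, ∃ ρ > 0, ∃ b : H → ℝ, Differentiable ℝ b ∧ (∃ C, LipschitzWith C b) ∧
      (∀ y, 0 ≤ b y) ∧ (∀ y ∈ Metric.ball x ρ, b y = 1) ∧ ∀ y ∈ L, b y = 0 := by
    intro x hx
    obtain ⟨r, hr, hrL⟩ := Metric.isOpen_iff.1 hL.isOpen_compl x (Set.disjoint_left.1 hKL hx)
    obtain ⟨ρ, hρ, b, hd, hl, h0, h1, hb⟩ := exists_differentiable_lipschitz_bump x hr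
    exact ⟨ρ, hρ, b, hd, hl, h0, h1, fun y hy => hb y (not_lt.1 fun h => hrL h hy)⟩
  have hg : ∃ g : H → ℝ, Differentiable ℝ g ∧ (∃ C, LipschitzWith C g) ∧ (∀ y, 0 ≤ g y) ∧
      (∀ y ∈ K, 1 ≤ g y) ∧ ∀ y ∈ L, g y = 0 := by
    refine hK.induction_on (p := fun s => ∃ g : H → ℝ, Differentiable ℝ g ∧
      (∃ C, LipschitzWith C g) ∧ (∀ y, 0 ≤ g y) ∧ (∀ y ∈ s, 1 ≤ g y) ∧ ∀ y ∈ L, g y = 0)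
      ?_ ?_ ?_ ?_
    · exact ⟨fun _ => 0, differentiable_const _, ⟨0, LipschitzWith.const _⟩, fun _ => le_rfl,
        by simp, fun _ _ => rfl⟩
    · rintro s t hst ⟨g, hd, hl, h0, h1, hL⟩
      exact ⟨g, hd, hl, h0, fun y hy => h1 y (hst hy), hL⟩
    · rintro s t ⟨g, hd, ⟨C, hl⟩, h0, h1, hL⟩ ⟨g', hd', ⟨C', hl'⟩, h0', h1', hL'⟩
      refine ⟨fun y => g y + g' y, hd.add hd', ⟨_, hl.add hl'⟩,
        fun y => add_nonneg (h0 y) (h0' y), ?_, fun y hy => by simp [hL y hy, hL' y hy]⟩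
      rintro y (hy | hy)
      · linarith [h1 y hy, h0' y]
      · linarith [h1' y hy, h0 y]
    · intro x hx
      obtain ⟨ρ, hρ, b, hd, hl, h0, h1, hb⟩ := hpt x hx
      exact ⟨Metric.ball x ρ, mem_nhdsWithin_of_mem_nhds (Metric.ball_mem_nhds x hρ), b, hd, hl,
        h0, fun y hy => (h1 y hy).ge, hb⟩
  obtain ⟨g, hd, ⟨C, hl⟩, h0, h1, hgL⟩ := hg
  let f : ContDiffBump (0 : ℝ) := ⟨1 / 2, 1, by norm_num, by norm_num⟩
  obtain ⟨C', hC'⟩ := ContDiff.lipschitzWith_of_hasCompactSupport f.hasCompactSupport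
    (f.contDiff (n := 1)) one_ne_zero
  refine ⟨fun y => 1 - f (g y), ?_, ⟨_, (LipschitzWith.const 1).sub (hC'.comp hl)⟩,
    fun y => sub_nonneg.2 f.le_one, fun y => sub_le_self _ f.nonneg, fun y hy => ?_,
    fun y hy => ?_⟩
  · exact (((f.contDiff (n := 1)).differentiable one_ne_zero).comp hd).const_sub 1
  · have : f (g y) = 0 := f.zero_of_le_dist (by simpa [f, abs_of_nonneg (h0 y)] using h1 y hy)
    simp [this]
  · have : f (g y) = 1 := f.one_of_mem_closedBall (by simp [f, hgL y hy])
    simp [this]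

/-- Mutually singular probability measures are at distance two, tested on differentiable Lipschitz
functions. -/
theorem MeasureTheory.Measure.MutuallySingular.exists_differentiable_lipschitz [CompleteSpace H]
    [TopologicalSpace.SeparableSpace H] [MeasurableSpace H] [BorelSpace H] {μ ν : Measure H}
    [IsProbabilityMeasure μ] [IsProbabilityMeasure ν] (h : μ.MutuallySingular ν) {η : ℝ}
    (hη : 0 < η) :
    ∃ φ : H → ℝ, Differentiable ℝ φ ∧ (∃ C, LipschitzWith C φ) ∧ (∀ y, 0 ≤ φ y) ∧
      (∀ y, φ y ≤ 1) ∧ 1 - η < ∫ y, φ y ∂μ - ∫ y, φ y ∂ν := by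
  have := UniformSpace.secondCountable_of_separable H
  obtain ⟨S, hS, hμS, hνS⟩ := h
  have approx : ∀ (m : Measure H) [IsProbabilityMeasure m] (A : Set H), MeasurableSet A →
      m Aᶜ = 0 → ∃ K ⊆ A, IsCompact K ∧ 1 - η / 2 < m.real K := by
    intro m _ A hA hm
    obtain ⟨K, hKA, hK, hlt⟩ := hA.exists_isCompact_lt_add (measure_ne_top m A)
      (ENNReal.ofReal_pos.2 (half_pos hη)).ne'
    refine ⟨K, hKA, hK, ?_⟩
    rw [(prob_compl_eq_zero_iff hA).1 hm] at hlt
    have := (ENNReal.toReal_lt_toReal ENNReal.one_ne_top (by finiteness)).2 hlt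
    rw [ENNReal.toReal_add (by finiteness) (by finiteness),
      ENNReal.toReal_ofReal (half_pos hη).le, ENNReal.toReal_one] at this
    rw [measureReal_def]
    linarith
  obtain ⟨K, hKS, hK, hKm⟩ := approx μ Sᶜ hS.compl (by rwa [compl_compl])
  obtain ⟨L, hLS, hL, hLm⟩ := approx ν S hS hνS
  obtain ⟨φ, hd, hl, h0, h1, hφK, hφL⟩ := exists_differentiable_lipschitz_separating hK
    hL.isClosed (Set.disjoint_left.2 fun y hy hy' => hKS hy (hLS hy'))
  have hint : ∀ (m : Measure H) [IsProbabilityMeasure m], Integrable φ m := fun m _ =>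
    Integrable.of_bound hd.continuous.aestronglyMeasurable 1
      (Eventually.of_forall fun y => by simpa [abs_of_nonneg (h0 y)] using h1 y)
  refine ⟨φ, hd, hl, h0, h1, ?_⟩
  have hμ : μ.real K ≤ ∫ y, φ y ∂μ := by
    rw [← integral_indicator_one hK.measurableSet]
    refine integral_mono ((integrable_const 1).indicator hK.measurableSet) (hint μ) fun y => ?_
    by_cases hy : y ∈ K
    · simp [hy, hφK y hy]
    · simp [hy, h0 y]
  have hν : ∫ y, φ y ∂ν ≤ 1 - ν.real L := by
    rw [← probReal_compl_eq_one_sub hL.measurableSet,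
      ← integral_indicator_one hL.measurableSet.compl]
    refine integral_mono (hint ν) ((integrable_const 1).indicator hL.measurableSet.compl)
      fun y => ?_
    by_cases hy : y ∈ L
    · simp [hy, hφL y hy]
    · simp [hy, h1 y]
  linarith

end Separation

/-- If `g` takes values in `[0, 1]` and is at most `1 / 4` away from a constant on `A`, its
integrals against two probability measures charging `A` differ by strictly less than one. -/
theorem integral_sub_integral_le_of_near_const {X : Type*} [MeasurableSpace X] {μ ν : Measure X}
    [IsProbabilityMeasure μ] [IsProbabilityMeasure ν] {A : Set X} (hA : MeasurableSet A)
    {g : X → ℝ} (hgμ : Integrable g μ) (hgν : Integrable g ν) (h0 : ∀ x, 0 ≤ g x)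
    (h1 : ∀ x, g x ≤ 1) {p : ℝ} (hp : ∀ x ∈ A, |g x - p| ≤ 1 / 4) :
    ∫ x, g x ∂μ - ∫ x, g x ∂ν ≤ 1 - min (μ.real A) (ν.real A) / 2 := by
  -- Clipping to `[0, 1]` keeps `1 - M` and `m` nonnegative, so both masses may be replaced by their
  -- minimum.
  set M := min (p + 1 / 4) 1
  set m := max (p - 1 / 4) 0
  have hμ : ∫ x, g x ∂μ ≤ 1 - μ.real A * (1 - M) := by
    calc ∫ x, g x ∂μ ≤ ∫ x, (1 - A.indicator (fun _ => 1 - M) x) ∂μ := by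
          refine integral_mono hgμ
            ((integrable_const _).sub ((integrable_const _).indicator hA)) fun x => ?_
          by_cases hx : x ∈ A
          · have := abs_le.1 (hp x hx)
            have h2 : g x ≤ M := le_min (by linarith) (h1 x)
            simpa [hx] using h2
          · simpa [hx] using h1 x
      _ = 1 - μ.real A * (1 - M) := by
          rw [integral_sub (integrable_const _) ((integrable_const _).indicator hA),
            integral_indicator_const _ hA]
          simp
  have hν : ν.real A * m ≤ ∫ x, g x ∂ν := by
    rw [← smul_eq_mul, ← integral_indicator_const m hA]
    refine integral_mono ((integrable_const _).indicator hA) hgν fun x => ?_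
    by_cases hx : x ∈ A
    · have := abs_le.1 (hp x hx)
      have h2 : m ≤ g x := max_le (by linarith) (h0 x)
      simpa [hx] using h2
    · simpa [hx] using h0 x
  set α := min (μ.real A) (ν.real A)
  have hα : 0 ≤ α := le_min measureReal_nonneg measureReal_nonneg
  have hM1 : M ≤ 1 := min_le_right _ _
  have hm0 : 0 ≤ m := le_max_right _ _
  have hMm : M - m ≤ 1 / 2 := by
    have h2 : M ≤ p + 1 / 4 := min_le_left _ _
    have h3 : p - 1 / 4 ≤ m := le_max_left _ _
    linarith
  have e1 : α * (1 - M) ≤ μ.real A * (1 - M) :=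
    mul_le_mul_of_nonneg_right (min_le_left _ _) (by linarith)
  have e2 : α * m ≤ ν.real A * m := mul_le_mul_of_nonneg_right (min_le_right _ _) hm0
  nlinarith

/-! ### Uniform oscillation bound and conclusion -/

section GradientEstimate

variable {H : Type*} [NormedAddCommGroup H] [InnerProductSpace ℝ H] [MeasurableSpace H]
  {P : ℝ≥0 → Kernel H H} {t : ℕ → ℝ≥0} {δ : ℕ → ℝ} {C : ℝ≥0 → ℝ}

/-- Under the gradient estimate, the image of a test function by the semigroup at a suitable time is
Lipschitz on a ball, with a constant that does not depend on the test function. -/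
theorem GradientEstimate.exists_lipschitz_on_ball (hδ : ∀ n, 0 < δ n)
    (hδ0 : Tendsto δ atTop (𝓝 0)) (hC : Monotone C) (h : GradientEstimate P t δ C) {φ : H → ℝ}
    (hd : Differentiable ℝ φ) {L : ℝ≥0} (hl : LipschitzWith L φ) (h0 : ∀ y, 0 ≤ φ y)
    (h1 : ∀ y, φ y ≤ 1) {r : ℝ≥0} {v : H} {ε : ℝ} (hv : ‖v‖ + ε ≤ r) :
    ∃ n, Differentiable ℝ (semigroupAction P (t n) φ) ∧ ∀ u ∈ Metric.ball v ε,
      |semigroupAction P (t n) φ u - semigroupAction P (t n) φ v| ≤ 2 * max (C r) 0 * ε := by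
  have hφ1 : ∀ y, ‖φ y‖ ≤ 1 := fun y => by simpa [abs_of_nonneg (h0 y)] using h1 y
  have hφL : ∀ y, ‖fderiv ℝ φ y‖ ≤ L := fun y => norm_fderiv_le_of_lipschitz ℝ hl
  -- This `n` depends on `φ`, but it bounds the bracket in the estimate by `2` for every `φ`.
  obtain ⟨n, hn⟩ : ∃ n, δ n * L ≤ 1 := by
    have : Tendsto (fun n => δ n * L) atTop (𝓝 0) := by simpa using hδ0.mul_const (L : ℝ)
    exact (this.eventually_le_const one_pos).exists
  obtain ⟨hdiff, hgrad⟩ := h φ hd ⟨1, by rintro _ ⟨y, rfl⟩; exact hφ1 y⟩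
    ⟨L, by rintro _ ⟨y, rfl⟩; exact hφL y⟩ n
  have hs0 : 0 ≤ supNorm φ := Real.iSup_nonneg fun y => norm_nonneg _
  have hs1 : supNorm φ ≤ 1 := Real.iSup_le hφ1 zero_le_one
  have hL0 : 0 ≤ supNorm (fderiv ℝ φ) := Real.iSup_nonneg fun y => norm_nonneg _
  have hL1 : supNorm (fderiv ℝ φ) ≤ L := Real.iSup_le hφL L.2
  have hδL : δ n * supNorm (fderiv ℝ φ) ≤ 1 :=
    (mul_le_mul_of_nonneg_left hL1 (hδ n).le).trans hn
  have hδL0 : 0 ≤ δ n * supNorm (fderiv ℝ φ) := mul_nonneg (hδ n).le hL0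
  refine ⟨n, hdiff, fun u hu => ?_⟩
  have hε : 0 < ε := Metric.pos_of_mem_ball hu
  have hbound : ∀ x ∈ Metric.ball v ε,
      ‖fderiv ℝ (semigroupAction P (t n) φ) x‖ ≤ 2 * max (C r) 0 := by
    intro x hx
    have hxr : ‖x‖₊ ≤ r := by
      rw [← NNReal.coe_le_coe, coe_nnnorm]
      rw [mem_ball_iff_norm] at hx
      linarith [norm_le_norm_add_norm_sub' x v]
    calc _ ≤ C ‖x‖₊ * (supNorm φ + δ n * supNorm (fderiv ℝ φ)) := hgrad x
      _ ≤ max (C r) 0 * (supNorm φ + δ n * supNorm (fderiv ℝ φ)) :=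
        mul_le_mul_of_nonneg_right ((hC hxr).trans (le_max_left _ _)) (by linarith)
      _ ≤ max (C r) 0 * 2 := mul_le_mul_of_nonneg_left (by linarith) (le_max_right _ _)
      _ = _ := mul_comm _ _
  calc _ ≤ 2 * max (C r) 0 * ‖u - v‖ :=
        (convex_ball v ε).norm_image_sub_le_of_norm_fderiv_le (fun x _ => hdiff x) hbound
          (Metric.mem_ball_self hε) hu
    _ ≤ _ := mul_le_mul_of_nonneg_left (mem_ball_iff_norm.1 hu).le (by positivity)

end GradientEstimate

theorem exists_ball_measure_ne_zero {E : Type*} [SeminormedAddCommGroup E] [MeasurableSpace E]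
    {μ : Measure E} [NeZero μ] : ∃ R : ℕ, ∀ r : ℝ, R ≤ r → μ (Metric.closedBall 0 r) ≠ 0 := by
  by_contra! h
  refine NeZero.ne μ (Measure.measure_univ_eq_zero.1 ?_)
  rw [← Metric.iUnion_closedBall_nat (0 : E), measure_iUnion_null_iff]
  intro n
  obtain ⟨r, hr, h0⟩ := h n
  exact measure_mono_null (Metric.closedBall_subset_closedBall hr) h0

theorem mainTheorem10 {H : Type*} [NormedAddCommGroup H] [InnerProductSpace ℝ H] [CompleteSpace H]
    [TopologicalSpace.SeparableSpace H] [MeasurableSpace H] [BorelSpace H]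
    (P : ℝ≥0 → Kernel H H) (hP : IsMarkovSemigroup P)
    (hSF : ∃ (t : ℕ → ℝ≥0) (δ : ℕ → ℝ) (C : ℝ≥0 → ℝ),
      (∀ n, 0 < t n) ∧ Monotone t ∧ (∀ n, 0 < δ n) ∧ Tendsto δ atTop (𝓝 0) ∧ Monotone C ∧
        GradientEstimate P t δ C)
    (hIrr : ∀ R₀ : ℝ, 0 < R₀ → ∃ (R : ℝ) (T : ℝ≥0), 0 < R ∧ 0 < T ∧
      ∀ ε : ℝ, 0 < ε → ∃ v : H, ‖v‖ ≤ R ∧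
        ∀ u : H, ‖u‖ ≤ R₀ → 0 < P T u (Metric.ball v ε)) :
    ∀ μ ν : Measure H, IsProbabilityMeasure μ → IsProbabilityMeasure ν →
      IsInvariantFor P μ → IsInvariantFor P ν → μ = ν := by
  intro μ₀ ν₀ _ _ hμ₀ hν₀
  have := hP.isMarkovKernel
  have := UniformSpace.secondCountable_of_separable H
  by_contra hne
  obtain ⟨μ, ν, _, _, hμ, hν, hsing⟩ := exists_mutuallySingular_of_ne hμ₀ hν₀ hne
  obtain ⟨t, δ, C, -, -, hδ, hδ0, hC, hgrad⟩ := hSF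
  obtain ⟨r₁, hr₁⟩ := exists_ball_measure_ne_zero (μ := μ)
  obtain ⟨r₂, hr₂⟩ := exists_ball_measure_ne_zero (μ := ν)
  -- The closed ball of this radius is charged by both measures; the `1` makes the radius positive.
  obtain ⟨R, T, hR, -, hirr⟩ := hIrr (r₁ + r₂ + 1) (by positivity)
  let r : ℝ≥0 := ⟨R + 1, by positivity⟩
  let D : ℝ := max (C r) 0
  have hD : 0 ≤ D := le_max_right _ _
  -- Small enough for oscillation at most `1 / 4`, and for the ball to stay within radius `R + 1`.
  let ε : ℝ := 1 / (8 * (D + 1))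
  have hε : 0 < ε := by positivity
  have hε1 : ε ≤ 1 := by
    rw [div_le_one (by positivity)]
    linarith
  have hDε : 2 * D * ε ≤ 1 / 4 := by
    rw [mul_one_div, div_le_iff₀ (by positivity)]
    linarith
  obtain ⟨v, hv, hpos⟩ := hirr ε hε
  have hA : MeasurableSet (Metric.ball v ε) := Metric.isOpen_ball.measurableSet
  have hμA : 0 < μ (Metric.ball v ε) :=
    (hμ T).measure_pos hA (hr₁ (r₁ + r₂ + 1) (by linarith [Nat.cast_nonneg (α := ℝ) r₂]))
      fun u hu => hpos u (mem_closedBall_zero_iff.1 hu)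
  have hνA : 0 < ν (Metric.ball v ε) :=
    (hν T).measure_pos hA (hr₂ (r₁ + r₂ + 1) (by linarith [Nat.cast_nonneg (α := ℝ) r₁]))
      fun u hu => hpos u (mem_closedBall_zero_iff.1 hu)
  have hα : 0 < min (μ.real (Metric.ball v ε)) (ν.real (Metric.ball v ε)) / 2 :=
    half_pos (lt_min (ENNReal.toReal_pos hμA.ne' (measure_ne_top _ _))
      (ENNReal.toReal_pos hνA.ne' (measure_ne_top _ _)))
  -- The tolerance is exactly the deficit in `key`; it was fixed before `φ`.
  obtain ⟨φ, hd, ⟨L, hl⟩, h0, h1, hφ⟩ := hsing.exists_differentiable_lipschitz hα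
  obtain ⟨n, hdiff, hosc⟩ := hgrad.exists_lipschitz_on_ball hδ hδ0 hC hd hl h0 h1 (r := r) (v := v)
    (ε := ε) (add_le_add hv hε1)
  have hint : ∀ (m : Measure H) [IsProbabilityMeasure m] (ψ : H → ℝ), Continuous ψ →
      (∀ y, 0 ≤ ψ y) → (∀ y, ψ y ≤ 1) → Integrable ψ m := fun m _ ψ hc hψ0 hψ1 =>
    Integrable.of_bound hc.aestronglyMeasurable 1
      (Eventually.of_forall fun y => by simpa [abs_of_nonneg (hψ0 y)] using hψ1 y)
  have hφi : ∀ (m : Measure H) [IsProbabilityMeasure m], Integrable φ m :=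
    fun m _ => hint m φ hd.continuous h0 h1
  have hg0 : ∀ u, 0 ≤ semigroupAction P (t n) φ u := fun u => integral_nonneg h0
  have hg1 : ∀ u, semigroupAction P (t n) φ u ≤ 1 := fun u => by
    simpa [semigroupAction] using integral_mono (hφi (P (t n) u)) (integrable_const 1) h1
  have key := integral_sub_integral_le_of_near_const hA
    (hint μ _ hdiff.continuous hg0 hg1) (hint ν _ hdiff.continuous hg0 hg1) hg0 hg1
    fun u hu => (hosc u hu).trans hDε
  have e1 : ∫ u, semigroupAction P (t n) φ u ∂μ = ∫ u, φ u ∂μ := (hμ _).integral_integral (hφi μ)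
  have e2 : ∫ u, semigroupAction P (t n) φ u ∂ν = ∫ u, φ u ∂ν := (hν _).integral_integral (hφi ν)
  rw [e1, e2] at key
  linarith
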